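/- **Notation.** Let $n\in\mathbb N$. $\|\cdot\|$ is the Euclidean norm on $\mathbb R^n$ and the induced operator norm on matrices; for a bounded function $\phi$ on $\mathbb R$ put also $\|\phi\|=\sup_{t\in\mathbb R}\|\phi(t)\|$. A set $S\subseteq\mathbb R$ is *relatively dense* if for some $l>0$ every interval $[a,a+l]$ meets $S$. A function $\phi$ on $\mathbb R$ is *almost periodic* if it is bounded, uniformly continuous, and for every $\varepsilon>0$ the set of $\tau$ with $\|\phi(t+\tau)-\phi(t)\|<\varepsilon$ for all $t$ is relatively dense. $\Theta$ is the set of strictly increasing sequences $\theta=(\theta_i)_{i\in\mathbb Z}$ of reals with $|\theta_i|\to\infty$ as $|i|\to\infty$. A *representative* of $\theta\in\Theta$ is a nondecreasing sequence $(\gamma_i)_{i\in\mathbb Z}$ whose set of values is $\{\theta_i\}$ and in which each $\theta_i$ is repeated at most $m$ times, for some $m$ independent of $i$. $\theta$ is a *Wexler sequence* if it has a representative $\gamma$ such that for every $\varepsilon>0$ the set of $p\in\mathbb Z$ with $|(\gamma_{i+p+j}-\gamma_{i+p})-(\gamma_{i+j}-\gamma_i)|<\varepsilon$ for all $i,j\in\mathbb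 Z$ is relatively dense. $\theta^{(1)},\theta^{(2)}\in\Theta$ are *$\varepsilon$-equivalent* if they have representatives with $\sup_i|\gamma^{(1)}_i-\gamma^{(2)}_i|<\varepsilon$. A function $\phi:\mathbb R\to\mathbb R^n$ belongs to $\mathcal{PC}_r$, with moments of (possible) discontinuity $\theta\in\Theta$, if it is uniformly continuous on the intervals $(\theta_i,\theta_{i+1})$ with a modulus independent of $i$, has left limits at the $\theta_i$, and is right continuous at the $\theta_i$. Functions $u_1,u_2\in\mathcal{PC}_r$ with moments of discontinuity $\theta^{(1)},\theta^{(2)}$ are *$\varepsilon$-equivalent* if $\theta^{(1)},\theta^{(2)}$ are, and $\|u_1(t)-u_2(t)\|<\varepsilon$ for all $t\notin\bigcup_i\big[(\theta^{(1)}_i-\varepsilon,\theta^{(1)}_i+\varepsilon)\cup(\theta^{(2)}_i-\varepsilon,\theta^{(2)}_i+\varepsilon)\big]$. A translate $\phi(\cdot+\tau)$ is given the moments of discontinuity $\theta_i-\tau$. $\phi\in\mathcal{PC}_r$ is *Bohr–Wexler almost periodic* if $\theta$ is a Wexler sequence and, for every $\varepsilon>0$, the set of $\tau$ such that $\phi(\cdot+\tau)$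 and $\phi$ are $\varepsilon$-equivalent is relatively dense. A real sequence $h=(h_k)_{k\in\mathbb N}$ is *regular* for an almost periodic $\phi$ if $\phi(\cdot+h_k)$ converges uniformly on $\mathbb R$; it is regular for $f\in\mathcal{PC}_r$ if for some $f^*\in\mathcal{PC}_r$ and every $\varepsilon>0$, $f(\cdot+h_k)$ and $f^*$ are $\varepsilon$-equivalent for all large $k$. $\mathcal L(\phi)$ is the set of sequences regular for $\phi$, and $\mathcal L(A,f)=\mathcal L(A)\cap\mathcal L(f)$. **Statement.** Let $A(t)$ be an almost periodic real $n\times n$ matrix function, $X(t)$ a fundamental matrix of $x'=A(t)x$, and suppose that there are a projection $P$ and constants $K_1,K_2,\sigma_1,\sigma_2>0$ with $$\|X(t)PX^{-1}(s)\|\le K_1e^{-\sigma_1(t-s)}\ (t\ge s),\qquad \|X(t)(I-P)X^{-1}(s)\|\le K_2e^{-\sigma_2(s-t)}\ (t\le s)$$ (exponential dichotomy). Let $f:\mathbb R\to\mathbb R^n$ be bounded and Bohr–Wexler almost periodic, with moments of discontinuity $\theta$. A *solution* of $x'=A(t)x+f(t)$ is a continuous $x:\mathbb R\to\mathbb R^n$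 that is differentiable and satisfies the equation at every $t\notin\{\theta_i\}$, has one-sided derivatives at each $\theta_i$, and satisfies the equation there with the right derivative. Then $x'=A(t)x+f(t)$ has exactly one almost periodic solution $x_0$, and $$\mathcal L(A,f)\subseteq\mathcal L(x_0),\qquad \|x_0\|\le\Big(\frac{K_1}{\sigma_1}+\frac{K_2}{\sigma_2}\Big)\|f\|.$$ -/

import Mathlib

open Set Filter Topology
open scoped Matrix.Norms.L2Operator

/-! Matrices carry the operator norm induced by the Euclidean norm of `ℝⁿ`. -/

namespace BWAP

/-- A set `S ⊆ ℝ` is relatively dense if some length `l > 0` has the property that every interval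
`[a, a + l]` meets `S`. -/
def RelDense (S : Set ℝ) : Prop :=
  ∃ l : ℝ, 0 < l ∧ ∀ a : ℝ, (Icc a (a + l) ∩ S).Nonempty

section AlmostPeriodic

variable {E : Type*} [NormedAddCommGroup E]

/-- `φ` is bounded on `ℝ`. -/
def IsBdd (φ : ℝ → E) : Prop :=
  ∃ M : ℝ, ∀ t, ‖φ t‖ ≤ M

/-- (Bohr) almost periodic functions: bounded, uniformly continuous, and for every `ε > 0` the
`ε`-translation numbers are relatively dense. -/
def IsAP (φ : ℝ → E) : Prop :=
  IsBdd φ ∧ UniformContinuous φ ∧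
    ∀ ε : ℝ, 0 < ε → RelDense {τ | ∀ t, ‖φ (t + τ) - φ t‖ < ε}

/-- The sup norm over `ℝ` (meaningful for bounded functions). -/
noncomputable def supNorm (φ : ℝ → E) : ℝ :=
  ⨆ t, ‖φ t‖

/-- The set of sequences `h` that are regular with respect to `φ`: the translates `φ(t + hₙ)`
converge uniformly on `ℝ`. -/
def regAP (φ : ℝ → E) : Set (ℕ → ℝ) :=
  {h | ∃ ψ : ℝ → E, TendstoUniformly (fun n t => φ (t + h n)) ψ atTop}

end AlmostPeriodic

/-- The space `Θ`: strictly increasing `θ : ℤ → ℝ` with `|θ i| → ∞` as `|i| → ∞`. -/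
def IsTheta (θ : ℤ → ℝ) : Prop :=
  StrictMono θ ∧ Tendsto (fun i => |θ i|) cofinite atTop

/-- `γ` is a representative of `θ`: a nondecreasing sequence whose terms run through exactly the
terms of `θ`, each one being repeated at least once and at most `m` times, for some `m`. -/
def IsRepr (γ θ : ℤ → ℝ) : Prop :=
  Monotone γ ∧ range γ = range θ ∧
    ∃ m : ℕ, ∀ i, {k | γ k = θ i}.Finite ∧ {k | γ k = θ i}.ncard ≤ m

/-- `θ₁` and `θ₂` are `ε`-equivalent: they have representatives with
`sup_i |γ₁ i - γ₂ i| < ε`. -/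
def SeqEquiv (ε : ℝ) (θ₁ θ₂ : ℤ → ℝ) : Prop :=
  ∃ γ₁ γ₂ : ℤ → ℝ, IsRepr γ₁ θ₁ ∧ IsRepr γ₂ θ₂ ∧
    ∃ δ : ℝ, δ < ε ∧ ∀ i, |γ₁ i - γ₂ i| ≤ δ

/-- The difference sequence `γ^j`, that is `γ_i^j = γ_{i+j} - γ_i`. -/
def diffSeq (γ : ℤ → ℝ) (j : ℤ) : ℤ → ℝ :=
  fun i => γ (i + j) - γ i

/-- The sequences `γ^j`, `j ∈ ℤ`, are equipotentially almost periodic: for every `ε > 0` the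
integers that are `ε`-almost periods of all of them simultaneously are relatively dense. -/
def EquiAP (γ : ℤ → ℝ) : Prop :=
  ∀ ε : ℝ, 0 < ε →
    RelDense ((fun p : ℤ => (p : ℝ)) ''
      {p : ℤ | ∀ j i : ℤ, |diffSeq γ j (i + p) - diffSeq γ j i| < ε})

/-- Wexler sequences. -/
def IsWexler (θ : ℤ → ℝ) : Prop :=
  IsTheta θ ∧ ∃ γ, IsRepr γ θ ∧ EquiAP γ

section Piecewise

variable {E : Type*} [NormedAddCommGroup E]

/-- `φ ∈ PC_r`, with moments of discontinuity `θ ∈ Θ`: uniformly continuous on the intervals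
`(θ_i, θ_{i+1})` with a modulus that does not depend on `i`, with left limits and right continuous
at the points `θ_i`. -/
def IsPCr (θ : ℤ → ℝ) (φ : ℝ → E) : Prop :=
  IsTheta θ ∧
  (∀ ε : ℝ, 0 < ε → ∃ δ : ℝ, 0 < δ ∧ ∀ i : ℤ, ∀ s ∈ Ioo (θ i) (θ (i + 1)),
    ∀ t ∈ Ioo (θ i) (θ (i + 1)), |s - t| < δ → ‖φ s - φ t‖ < ε) ∧
  (∀ i, ∃ v, Tendsto φ (𝓝[<] (θ i)) (𝓝 v)) ∧
  (∀ i, ContinuousWithinAt φ (Ici (θ i)) (θ i))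

/-- `u₁`, with moments of discontinuity `θ₁`, and `u₂`, with moments of discontinuity `θ₂`, are
`ε`-equivalent: so are `θ₁` and `θ₂`, and `‖u₁ t - u₂ t‖ < ε` for all `t` outside the open
`ε`-neighbourhoods of the moments of discontinuity. -/
def FunEquiv (ε : ℝ) (θ₁ : ℤ → ℝ) (u₁ : ℝ → E) (θ₂ : ℤ → ℝ) (u₂ : ℝ → E) : Prop :=
  SeqEquiv ε θ₁ θ₂ ∧
    ∀ t : ℝ, (∀ i, t ∉ Ioo (θ₁ i - ε) (θ₁ i + ε) ∧ t ∉ Ioo (θ₂ i - ε) (θ₂ i + ε)) →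
      ‖u₁ t - u₂ t‖ < ε

/-- Bohr–Wexler almost periodic functions, with moments of discontinuity `θ`. The translate
`t ↦ φ (t + τ)` has the moments of discontinuity `θ i - τ`. -/
def IsBWAP (θ : ℤ → ℝ) (φ : ℝ → E) : Prop :=
  IsPCr θ φ ∧ IsWexler θ ∧
    ∀ ε : ℝ, 0 < ε →
      RelDense {τ | FunEquiv ε (fun i => θ i - τ) (fun t => φ (t + τ)) θ φ}

/-- The set of sequences `h` that are regular with respect to `φ ∈ PC_r`: the translates
`φ(t + hₙ)` converge in the B-topology to some `ψ ∈ PC_r`, that is, for every `ε > 0` they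
eventually lie in the `ε`-neighbourhood of `ψ`. -/
def regB (θ : ℤ → ℝ) (φ : ℝ → E) : Set (ℕ → ℝ) :=
  {h | ∃ (η : ℤ → ℝ) (ψ : ℝ → E), IsPCr η ψ ∧ ∀ ε : ℝ, 0 < ε →
    ∀ᶠ n in atTop, FunEquiv ε (fun i => θ i - h n) (fun t => φ (t + h n)) η ψ}

end Piecewise

/-- `X` is a fundamental matrix of `x' = A(t) x`. -/
def IsFundamental {n : ℕ} (A X : ℝ → Matrix (Fin n) (Fin n) ℝ) : Prop :=
  ∀ t, HasDerivAt X (A t * X t) t ∧ IsUnit (X t).det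

/-- The system with fundamental matrix `X` has an exponential dichotomy with projection `P` and
constants `K₁, σ₁, K₂, σ₂ > 0`. -/
def ExpDichotomy {n : ℕ} (X : ℝ → Matrix (Fin n) (Fin n) ℝ) (P : Matrix (Fin n) (Fin n) ℝ)
    (K₁ σ₁ K₂ σ₂ : ℝ) : Prop :=
  P * P = P ∧ 0 < K₁ ∧ 0 < σ₁ ∧ 0 < K₂ ∧ 0 < σ₂ ∧
  (∀ s t, s ≤ t → ‖X t * P * (X s)⁻¹‖ ≤ K₁ * Real.exp (-σ₁ * (t - s))) ∧
  (∀ s t, t ≤ s → ‖X t * (1 - P) * (X s)⁻¹‖ ≤ K₂ * Real.exp (-σ₂ * (s - t)))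

/-- `x` is a solution on `ℝ` of `x' = A(t) x + f(t)`, where `f` has moments of discontinuity `θ`:
it is continuous, differentiable off `θ`, has one-sided derivatives at every `θ_i`, and satisfies
the equation on every `[θ_i, θ_{i+1})`, with the right derivative at `θ_i`. -/
def IsSol {n : ℕ} (θ : ℤ → ℝ) (A : ℝ → Matrix (Fin n) (Fin n) ℝ)
    (f x : ℝ → EuclideanSpace ℝ (Fin n)) : Prop :=
  Continuous x ∧
  (∀ t, t ∉ range θ → HasDerivAt x (Matrix.toEuclideanCLM (𝕜 := ℝ) (A t) (x t) + f t) t) ∧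
  (∀ i, HasDerivWithinAt x
    (Matrix.toEuclideanCLM (𝕜 := ℝ) (A (θ i)) (x (θ i)) + f (θ i)) (Ici (θ i)) (θ i)) ∧
  (∀ i, ∃ v, HasDerivWithinAt x v (Iic (θ i)) (θ i))

end BWAP

/-!
Let `x` be a bounded solution of `x' = A x + f`. For every `τ` the difference `y = x(· + τ) - x` is
a bounded solution of `y' = A y + g` with
`g t = (A (t + τ) - A t) x(t + τ) + f (t + τ) - f t`. Under an exponential dichotomy a bounded
solution of such an equation is estimated by the supremum of the means `∫_a^{a+1} ‖g‖`
(`Dichotomous.norm_le_of_mean_le`), because the two halves of Green's function decay exponentially.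
The use of means, rather than of `sup ‖g‖`, is what makes discontinuous `f` harmless:
`f (t + τ) - f t` is small except near a translate of `θ`, a Wexler sequence has a uniformly bounded
number of terms in intervals of fixed length (`IsWexler.exists_card_bound`), and `f` is bounded, so
the exceptional set contributes little to the means (`integral_norm_le_of_le_off_nhds`).
Hence every common almost period of `A` and `f`, understood in this sense, is an almost period of
`x` (`Dichotomous.exists_translate_lt`).

Common almost periods are relatively dense (`relDense_common_almostPeriod`), by a pigeonhole
argument on two relatively dense sets together with the uniform continuity of `A`
(`RelDense.sub_near_sub`); thus `x` is almost periodic. If `h` is regular for `A` and `f`, the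
differences `h n - h m` of late terms are common almost periods (`exists_almostPeriod_of_regular`),
so the translates `x(· + h n)` form a uniform Cauchy sequence; thus `h` is regular for `x`.

The same estimate with `g = 0` gives uniqueness, and Green's formula gives existence with the stated
bound (`Dichotomous.exists_bounded`).
-/

open MeasureTheory

namespace BWAP

/-! ### Relatively dense sets -/

theorem RelDense.mono {S T : Set ℝ} (hS : RelDense S) (h : S ⊆ T) : RelDense T := by
  obtain ⟨l, hl, H⟩ := hS
  exact ⟨l, hl, fun a => (H a).mono (inter_subset_inter_right _ h)⟩

/-- The differences of elements of a relatively dense set `U` that are `δ`-close to differences of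
elements of another relatively dense set `V` form a relatively dense set. It is this fact that
produces common almost periods of two functions. -/
theorem RelDense.sub_near_sub {U V : Set ℝ} (hU : RelDense U) (hV : RelDense V) {δ : ℝ}
    (hδ : 0 < δ) :
    RelDense {τ | ∃ u ∈ U, ∃ u' ∈ U, ∃ v ∈ V, ∃ v' ∈ V, τ = u - u' ∧ |τ - (v - v')| < δ} := by
  obtain ⟨l, hl, HU⟩ := hU
  obtain ⟨k, hk, HV⟩ := hV
  choose u hu using HU
  choose v hv using HV
  -- `u a` and `v a` are chosen in `[a, a + l]` and `[a, a + k]`; the offset `u a - v a` lies in a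
  -- bounded interval, which is divided into finitely many cells of length `δ`.
  set b : ℝ → ℤ := fun a => ⌊(u a - v a) / δ⌋ with hb
  have hbfin : (range b).Finite := by
    apply (Set.finite_Icc ⌊-k / δ⌋ ⌊l / δ⌋).subset
    rintro _ ⟨a, rfl⟩
    have h1 := (hu a).1; have h2 := (hv a).1
    rw [mem_Icc] at h1 h2
    exact ⟨Int.floor_le_floor (div_le_div_of_nonneg_right (by linarith) hδ.le),
      Int.floor_le_floor (div_le_div_of_nonneg_right (by linarith) hδ.le)⟩
  have hrep : ∀ j, ∃ a, j ∈ range b → b a = j := fun j => by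
    by_cases h : j ∈ range b
    · obtain ⟨a, ha⟩ := h
      exact ⟨a, fun _ => ha⟩
    · exact ⟨0, fun h' => absurd h' h⟩
  choose r hr using hrep
  obtain ⟨R, hR⟩ := (hbfin.image fun j => |u (r j)|).bddAbove
  have hR' : ∀ a, |u (r (b a))| ≤ R := fun a => hR ⟨b a, ⟨a, rfl⟩, rfl⟩
  have hR0 : 0 ≤ R := (abs_nonneg _).trans (hR' 0)
  refine ⟨l + 2 * R, by linarith, fun a => ?_⟩
  set c := a + R with hc
  set d := r (b c) with hd
  have hbd : ⌊(u d - v d) / δ⌋ = ⌊(u c - v c) / δ⌋ := hr (b c) ⟨c, rfl⟩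
  refine ⟨u c - u d, ⟨?_, ?_⟩, u c, (hu c).2, u d, (hu d).2, v c, (hv c).2, v d, (hv d).2, rfl, ?_⟩
  · have := (hu c).1.1; have := (abs_le.1 (hR' c)).2; linarith
  · have := (hu c).1.2; have := (abs_le.1 (hR' c)).1; linarith
  · have := Int.abs_sub_lt_one_of_floor_eq_floor hbd
    rw [← sub_div, abs_div, abs_of_pos hδ, div_lt_one hδ, abs_sub_comm] at this
    rw [abs_lt] at this ⊢
    constructor <;> linarith

/-! ### Sequences of moments of discontinuity -/

section Sequences

theorem IsTheta.tendsto_atTop {θ : ℤ → ℝ} (h : IsTheta θ) : Tendsto θ atTop atTop := by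
  have h1 : Tendsto (fun i => |θ i|) atTop atTop :=
    h.2.mono_left atTop_le_cofinite
  refine h1.congr' ?_
  filter_upwards [h1.eventually_gt_atTop |θ 0|, eventually_ge_atTop 0] with i hi hi0
  have h2 : θ 0 ≤ θ i := h.1.monotone hi0
  rcases abs_cases (θ i) with h3 | h3
  · exact h3.1
  · have := neg_abs_le (θ 0); linarith

theorem IsTheta.tendsto_atBot {θ : ℤ → ℝ} (h : IsTheta θ) : Tendsto θ atBot atBot := by
  have h1 : Tendsto (fun i => |θ i|) atBot atTop :=
    h.2.mono_left atBot_le_cofinite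
  rw [← tendsto_neg_atTop_iff]
  refine h1.congr' ?_
  filter_upwards [h1.eventually_gt_atTop |θ 0|, eventually_le_atBot 0] with i hi hi0
  have h2 : θ i ≤ θ 0 := h.1.monotone hi0
  rcases abs_cases (θ i) with h3 | h3
  · have := le_abs_self (θ 0); linarith
  · exact h3.1

theorem IsTheta.exists_mem_Ico {θ : ℤ → ℝ} (h : IsTheta θ) (t : ℝ) :
    ∃ i, t ∈ Ico (θ i) (θ (i + 1)) := by
  obtain ⟨b, hb⟩ := (h.tendsto_atTop.eventually_gt_atTop t).exists
  obtain ⟨a, ha⟩ := (h.tendsto_atBot.eventually_lt_atBot t).exists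
  obtain ⟨i, hi, hmax⟩ := Int.exists_greatest_of_bdd (P := fun i => θ i ≤ t)
    ⟨b, fun z hz => (h.1.lt_iff_lt.1 (lt_of_le_of_lt hz hb)).le⟩ ⟨a, ha.le⟩
  refine ⟨i, hi, ?_⟩
  by_contra hlt
  have := hmax (i + 1) (not_lt.1 hlt)
  omega

/-- The terms of a Wexler sequence lying in an interval of length `3` are bounded in number: an
almost period moves any block of a representative to a fixed compact part of it. -/
theorem IsWexler.exists_card_bound {θ : ℤ → ℝ} (h : IsWexler θ) :
    ∃ N : ℕ, ∀ a : ℝ, ∃ F : Finset ℝ, F.card ≤ N ∧ ∀ i, θ i ∈ Icc a (a + 3) → θ i ∈ F := by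
  obtain ⟨hθ, γ, ⟨hmono, hrange, -⟩, hap⟩ := h
  obtain ⟨l, hl, H⟩ := hap 1 one_pos
  obtain ⟨i, hi⟩ := (hθ.tendsto_atTop.eventually_gt_atTop (γ ⌈l⌉ + 4)).exists
  obtain ⟨J₀, hJ₀⟩ : θ i ∈ range γ := hrange ▸ mem_range_self i
  set J := max J₀ 0 with hJ
  have hgap : ∀ k, γ k + 3 < γ (k + J) := by
    intro k
    -- an almost period `p` with `k + p ∈ [0, l]`; there the gap is more than `4`, and moving back
    -- to `k` costs less than `1`
    obtain ⟨_, ⟨h1, h2⟩, p, hp, rfl⟩ := H (-k)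
    have h0 : 0 ≤ k + p := by
      have : (0 : ℝ) ≤ ((k + p : ℤ) : ℝ) := by push_cast; linarith
      exact_mod_cast this
    have h3 : k + p ≤ ⌈l⌉ := by
      have : ((k + p : ℤ) : ℝ) ≤ (⌈l⌉ : ℝ) := by
        push_cast
        linarith [Int.le_ceil l]
      exact_mod_cast this
    have h4 := abs_lt.1 (hp J k)
    simp only [diffSeq] at h4
    have h5 : γ J₀ ≤ γ (k + p + J) := hmono (by omega)
    have h6 := hmono h3
    linarith [h4.2]
  refine ⟨(Finset.Ioo (-J) J).card, fun a => ?_⟩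
  by_cases hex : ∃ k, γ k ∈ Icc a (a + 3)
  · obtain ⟨k, hk⟩ := hex
    refine ⟨(Finset.Ioo (-J) J).image fun j => γ (k + j), Finset.card_image_le, fun i hi => ?_⟩
    obtain ⟨q, hq⟩ : θ i ∈ range γ := hrange ▸ mem_range_self i
    rw [← hq] at hi ⊢
    refine Finset.mem_image.2 ⟨q - k, Finset.mem_Ioo.2 ⟨?_, ?_⟩, by congr 1; ring⟩
    · by_contra hlt
      have := hgap q
      have h2 : γ (q + J) ≤ γ k := hmono (by omega)
      linarith [hk.2, hi.1]
    · by_contra hlt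
      have := hgap k
      have h2 : γ (k + J) ≤ γ q := hmono (by omega)
      linarith [hi.2, hk.1]
  · refine ⟨∅, by simp, fun i hi => absurd ?_ hex⟩
    obtain ⟨q, hq⟩ : θ i ∈ range γ := hrange ▸ mem_range_self i
    exact ⟨q, hq ▸ hi⟩

theorem SeqEquiv.symm {ε : ℝ} {θ₁ θ₂ : ℤ → ℝ} (h : SeqEquiv ε θ₁ θ₂) : SeqEquiv ε θ₂ θ₁ := by
  obtain ⟨γ₁, γ₂, h1, h2, δ, hδ, H⟩ := h
  exact ⟨γ₂, γ₁, h2, h1, δ, hδ, fun i => abs_sub_comm (γ₁ i) (γ₂ i) ▸ H i⟩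

theorem SeqEquiv.exists_near {ε : ℝ} {θ₁ θ₂ : ℤ → ℝ} (h : SeqEquiv ε θ₁ θ₂) (i : ℤ) :
    ∃ j, |θ₁ i - θ₂ j| < ε := by
  obtain ⟨γ₁, γ₂, h1, h2, δ, hδ, H⟩ := h
  obtain ⟨k, hk⟩ : θ₁ i ∈ range γ₁ := h1.2.1 ▸ mem_range_self i
  obtain ⟨j, hj⟩ : γ₂ k ∈ range θ₂ := h2.2.1 ▸ mem_range_self k
  exact ⟨j, by rw [← hk, hj]; exact (H k).trans_lt hδ⟩

/-- A point at distance at least `2ε` from `θ₂` is at distance at least `ε` from every sequence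
`θ₁` that is `ε`-equivalent to it. -/
theorem SeqEquiv.le_abs_sub {ε r : ℝ} {θ₁ θ₂ : ℤ → ℝ} (h : SeqEquiv ε θ₁ θ₂) {t : ℝ}
    (ht : ∀ j, r + ε ≤ |t - θ₂ j|) (i : ℤ) : r ≤ |t - θ₁ i| := by
  obtain ⟨j, hj⟩ := h.exists_near i
  have := abs_sub_le t (θ₁ i) (θ₂ j)
  linarith [ht j]

end Sequences

/-! ### Piecewise uniformly continuous functions and their means -/

section Piecewise

variable {E : Type*} [NormedAddCommGroup E]

theorem IsPCr.continuousAt {θ : ℤ → ℝ} {f : ℝ → E} (h : IsPCr θ f) {t : ℝ} (ht : t ∉ range θ) :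
    ContinuousAt f t := by
  obtain ⟨i, h1, h2⟩ := h.1.exists_mem_Ico t
  have h1' : θ i < t := lt_of_le_of_ne h1 fun e => ht ⟨i, e⟩
  rw [Metric.continuousAt_iff']
  intro ε hε
  obtain ⟨δ, hδ, H⟩ := h.2.1 ε hε
  filter_upwards [Ioo_mem_nhds h1' h2, Metric.ball_mem_nhds t hδ] with s hs hst
  rw [dist_eq_norm]
  exact H i s hs t ⟨h1', h2⟩ (by simpa [Real.dist_eq] using hst)

theorem IsPCr.continuousWithinAt_Ici {θ : ℤ → ℝ} {f : ℝ → E} (h : IsPCr θ f) (t : ℝ) :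
    ContinuousWithinAt f (Ici t) t := by
  by_cases ht : t ∈ range θ
  · obtain ⟨i, rfl⟩ := ht
    exact h.2.2.2 i
  · exact (h.continuousAt ht).continuousWithinAt

theorem IsPCr.aestronglyMeasurable {θ : ℤ → ℝ} {f : ℝ → E} (h : IsPCr θ f) :
    AEStronglyMeasurable f volume := by
  have hc : (range θ).Countable := countable_range θ
  have h1 : ContinuousOn f (range θ)ᶜ := fun t ht => (h.continuousAt ht).continuousWithinAt
  have h2 := h1.aestronglyMeasurable (μ := volume) hc.measurableSet.compl
  rwa [Measure.restrict_eq_self_of_ae_mem] at h2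
  exact hc.ae_notMem volume

/-- If `‖g‖ ≤ ε` off the `ε`-neighbourhood of a translate of `θ`, of which each interval of length
`3` contains at most `N` terms, and `‖g‖ ≤ M` everywhere, then the means of `‖g‖` over intervals of
length `1` are of the order of `ε`. -/
theorem integral_norm_le_of_le_off_nhds {θ : ℤ → ℝ} {N : ℕ}
    (hN : ∀ a : ℝ, ∃ F : Finset ℝ, F.card ≤ N ∧ ∀ i, θ i ∈ Icc a (a + 3) → θ i ∈ F)
    {g : ℝ → E} (hg : AEStronglyMeasurable g volume) {M : ℝ} (hM : ∀ t, ‖g t‖ ≤ M) {c ε : ℝ}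
    (hε : 0 < ε) (hε1 : ε ≤ 1) (H : ∀ t, (∀ i, ε ≤ |t - c - θ i|) → ‖g t‖ ≤ ε) (a : ℝ) :
    ∫ s in a..(a + 1), ‖g s‖ ≤ (1 + 2 * M * N) * ε := by
  obtain ⟨F, hF, hmem⟩ := hN (a - c - 1)
  have hM0 : 0 ≤ M := (norm_nonneg _).trans (hM 0)
  set ind : ℝ → ℝ → ℝ := fun x => indicator (Ioo (c + x - ε) (c + x + ε)) fun _ => M with hind
  have hindi : ∀ x, Integrable (ind x) volume := fun x =>
    (integrable_indicator_iff measurableSet_Ioo).2 (integrableOn_const (by simp))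
  have hind0 : ∀ x t, 0 ≤ ind x t := fun x t => indicator_nonneg (fun _ _ => hM0) t
  have hind1 : ∀ x, ∫ s in a..(a + 1), ind x s ≤ 2 * M * ε := fun x => by
    rw [intervalIntegral.integral_of_le (by linarith)]
    refine (setIntegral_le_integral (hindi x) (Eventually.of_forall (hind0 x))).trans ?_
    rw [integral_indicator measurableSet_Ioo]
    simp only [integral_const, MeasurableSet.univ, measureReal_restrict_apply, univ_inter,
      Real.volume_real_Ioo, smul_eq_mul]
    rw [max_eq_left (by linarith)]
    linarith
  have hsum : ∀ t ∈ Icc a (a + 1), ‖g t‖ ≤ ε + ∑ x ∈ F, ind x t := by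
    intro t ht
    by_cases hfar : ∀ i, ε ≤ |t - c - θ i|
    · exact (H t hfar).trans (le_add_of_nonneg_right (Finset.sum_nonneg fun x _ => hind0 x t))
    · push Not at hfar
      obtain ⟨i, hi⟩ := hfar
      have hi' := abs_lt.1 hi
      have hiF : θ i ∈ F := hmem i ⟨by linarith [ht.1], by linarith [ht.2]⟩
      have h1 : ind (θ i) t = M :=
        indicator_of_mem (show t ∈ Ioo _ _ from ⟨by linarith, by linarith⟩) _
      have h2 := Finset.single_le_sum (f := fun x => ind x t) (fun x _ => hind0 x t) hiF
      simp only [h1] at h2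
      linarith [hM t]
  have hgi : IntervalIntegrable g volume a (a + 1) :=
    (intervalIntegrable_const (c := M)).mono_fun hg.restrict (Eventually.of_forall fun t => by
      simpa [abs_of_nonneg hM0] using hM t)
  have hsi : IntervalIntegrable (fun t => ∑ x ∈ F, ind x t) volume a (a + 1) :=
    (integrable_finsetSum F fun x _ => hindi x).intervalIntegrable
  calc ∫ s in a..(a + 1), ‖g s‖ ≤ ∫ s in a..(a + 1), (ε + ∑ x ∈ F, ind x s) :=
        intervalIntegral.integral_mono_on (by linarith) hgi.norm
          (intervalIntegrable_const.add hsi) hsum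
    _ = ε + ∑ x ∈ F, ∫ s in a..(a + 1), ind x s := by
        rw [intervalIntegral.integral_add intervalIntegrable_const hsi,
          intervalIntegral.integral_finsetSum fun x _ => (hindi x).intervalIntegrable]
        simp
    _ ≤ ε + ∑ x ∈ F, 2 * M * ε := by gcongr with x; exact hind1 x
    _ = ε + F.card * (2 * M * ε) := by simp
    _ ≤ ε + N * (2 * M * ε) := by gcongr
    _ = _ := by ring

end Piecewise

/-! ### Exponential dichotomy: a priori estimate and Green's formula -/

section Dichotomy

theorem intervalIntegrable_of_norm_le {E : Type*} [NormedAddCommGroup E] {g : ℝ → E}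
    (hg : AEStronglyMeasurable g volume) {M : ℝ} (hM : ∀ t, ‖g t‖ ≤ M) (a b : ℝ) :
    IntervalIntegrable g volume a b :=
  (intervalIntegrable_const (c := M)).mono_fun hg.restrict (Eventually.of_forall fun t => by
    simpa using (hM t).trans (le_abs_self M))

variable {E : Type*} [NormedAddCommGroup E] [NormedSpace ℝ E]

/-- The data of a linear equation `x' = A(t) x` with an exponential dichotomy, for operators on a
normed space: `X` is a fundamental operator, `Y` its pointwise inverse. The solutions split along
`P + (1 - P) = 1` into a part decaying in the future and a part decaying in the past. -/
structure Dichotomous (A X Y : ℝ → E →L[ℝ] E) (P : E →L[ℝ] E) (K₁ σ₁ K₂ σ₂ : ℝ) : Prop where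
  hasDerivAt : ∀ t, HasDerivAt X (A t * X t) t
  mul_inv : ∀ t, X t * Y t = 1
  inv_mul : ∀ t, Y t * X t = 1
  K₁_pos : 0 < K₁
  σ₁_pos : 0 < σ₁
  K₂_pos : 0 < K₂
  σ₂_pos : 0 < σ₂
  norm_le₁ : ∀ s t, s ≤ t → ‖X t * P * Y s‖ ≤ K₁ * Real.exp (-σ₁ * (t - s))
  norm_le₂ : ∀ s t, t ≤ s → ‖X t * (1 - P) * Y s‖ ≤ K₂ * Real.exp (-σ₂ * (s - t))

variable {A X Y : ℝ → E →L[ℝ] E} {P : E →L[ℝ] E} {K₁ σ₁ K₂ σ₂ : ℝ}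

namespace Dichotomous

theorem apply_inv (h : Dichotomous A X Y P K₁ σ₁ K₂ σ₂) (t : ℝ) (v : E) : X t (Y t v) = v := by
  rw [← mul_apply_eq_comp, h.mul_inv]; rfl

theorem inv_apply (h : Dichotomous A X Y P K₁ σ₁ K₂ σ₂) (t : ℝ) (v : E) : Y t (X t v) = v := by
  rw [← mul_apply_eq_comp, h.inv_mul]; rfl

variable [CompleteSpace E]

theorem hasDerivAt_inv (h : Dichotomous A X Y P K₁ σ₁ K₂ σ₂) (t : ℝ) :
    HasDerivAt Y (-(Y t * A t)) t := by
  have hYX : Y = fun s => Ring.inverse (X s) := funext fun s => by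
    exact (Ring.inverse_unit (⟨X s, Y s, h.mul_inv s, h.inv_mul s⟩ : (E →L[ℝ] E)ˣ)).symm
  have h1 := hasFDerivAt_ringInverse (𝕜 := ℝ)
    (⟨X t, Y t, h.mul_inv t, h.inv_mul t⟩ : (E →L[ℝ] E)ˣ)
  have h2 := h1.comp_hasDerivAt t (h.hasDerivAt t)
  rw [hYX]
  refine h2.congr_deriv ?_
  have h3 : Ring.inverse (X t) = Y t := (congrFun hYX t).symm
  simp only [h3, Units.inv_mk, neg_apply,
    ContinuousLinearMap.mulLeftRight_apply]
  rw [mul_assoc, mul_assoc, h.mul_inv, mul_one]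

theorem continuous_inv (h : Dichotomous A X Y P K₁ σ₁ K₂ σ₂) : Continuous Y :=
  continuous_iff_continuousAt.2 fun t => (h.hasDerivAt_inv t).continuousAt

theorem aestronglyMeasurable_inv_apply (h : Dichotomous A X Y P K₁ σ₁ K₂ σ₂) {g : ℝ → E}
    (hg : AEStronglyMeasurable g volume) :
    AEStronglyMeasurable (fun t => Y t (g t)) volume := by
  have := (ContinuousLinearMap.id ℝ (E →L[ℝ] E)).aestronglyMeasurable_comp₂
    h.continuous_inv.aestronglyMeasurable hg
  simpa using this

theorem intervalIntegrable_inv_apply (h : Dichotomous A X Y P K₁ σ₁ K₂ σ₂) {g : ℝ → E}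
    (hg : AEStronglyMeasurable g volume) {M : ℝ} (hM : ∀ t, ‖g t‖ ≤ M) (a b : ℝ) :
    IntervalIntegrable (fun t => Y t (g t)) volume a b := by
  have h1 : IntervalIntegrable (fun t => ‖Y t‖ * M) volume a b :=
    (h.continuous_inv.norm.mul continuous_const).intervalIntegrable a b
  refine h1.mono_fun (h.aestronglyMeasurable_inv_apply hg).restrict (Eventually.of_forall
    fun t => ?_)
  refine ((Y t).le_opNorm_of_le (hM t)).trans (le_abs_self _)

/-- Variation of constants. -/
theorem inv_apply_sub_inv_apply (h : Dichotomous A X Y P K₁ σ₁ K₂ σ₂) {y g : ℝ → E}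
    (hy : Continuous y)
    (hy' : ∀ t, HasDerivWithinAt y (A t (y t) + g t) (Ici t) t)
    (hg : AEStronglyMeasurable g volume) {M : ℝ} (hM : ∀ t, ‖g t‖ ≤ M) (s t : ℝ) :
    ∫ u in s..t, Y u (g u) = Y t (y t) - Y s (y s) := by
  refine intervalIntegral.integral_eq_sub_of_hasDeriv_right (f := fun u => Y u (y u))
    (h.continuous_inv.clm_apply hy).continuousOn (fun u _ => ?_)
    (h.intervalIntegrable_inv_apply hg hM s t)
  have h1 := (h.hasDerivAt_inv u).hasDerivWithinAt.clm_apply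
    ((hy' u).mono Ioi_subset_Ici_self)
  refine h1.congr_deriv ?_
  simp

/-- The a priori estimate on a bounded window: for a solution `y` bounded by `B`, the value `y t` is
controlled by the right-hand side on `[t - N, t + N]`. -/
theorem norm_le_add_integral (h : Dichotomous A X Y P K₁ σ₁ K₂ σ₂) {y g : ℝ → E}
    (hy : Continuous y) (hy' : ∀ t, HasDerivWithinAt y (A t (y t) + g t) (Ici t) t)
    (hg : AEStronglyMeasurable g volume) {M : ℝ} (hM : ∀ t, ‖g t‖ ≤ M)
    {B : ℝ} (hB : ∀ t, ‖y t‖ ≤ B) (t : ℝ) {N : ℝ} (hN : 0 ≤ N) :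
    ‖y t‖ ≤ (K₁ * Real.exp (-σ₁ * N) * B + K₁ * ∫ u in (t - N)..t, Real.exp (-σ₁ * (t - u)) * ‖g u‖)
      + (K₂ * Real.exp (-σ₂ * N) * B +
        K₂ * ∫ u in t..(t + N), Real.exp (-σ₂ * (u - t)) * ‖g u‖) := by
  have hsplit : y t = X t (P (Y t (y t))) + X t ((1 - P) (Y t (y t))) := by
    rw [← map_add, ← add_apply]
    simp [h.apply_inv]
  have hint := h.intervalIntegrable_inv_apply hg hM
  have h1 : X t (P (Y t (y t))) = (X t * P * Y (t - N)) (y (t - N)) +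
      ∫ u in (t - N)..t, (X t * P * Y u) (g u) := by
    have e := (X t * P).intervalIntegral_comp_comm (hint (t - N) t)
    rw [h.inv_apply_sub_inv_apply hy hy' hg hM] at e
    simp only [mul_apply_eq_comp, map_sub] at e ⊢
    rw [e]; abel
  have h2 : X t ((1 - P) (Y t (y t))) = (X t * (1 - P) * Y (t + N)) (y (t + N)) -
      ∫ u in t..(t + N), (X t * (1 - P) * Y u) (g u) := by
    have e := (X t * (1 - P)).intervalIntegral_comp_comm (hint t (t + N))
    rw [h.inv_apply_sub_inv_apply hy hy' hg hM] at e
    simp only [mul_apply_eq_comp] at e ⊢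
    rw [e]; simp only [map_sub]; abel
  have hgn : ∀ a b, IntervalIntegrable (fun u => ‖g u‖) volume a b := fun a b =>
    (intervalIntegrable_of_norm_le hg hM a b).norm
  have b1 : ‖X t (P (Y t (y t)))‖ ≤ K₁ * Real.exp (-σ₁ * N) * B +
      K₁ * ∫ u in (t - N)..t, Real.exp (-σ₁ * (t - u)) * ‖g u‖ := by
    rw [h1]
    refine (norm_add_le _ _).trans (add_le_add ?_ ?_)
    · refine ((X t * P * Y (t - N)).le_opNorm_of_le (hB _)).trans ?_
      have := h.norm_le₁ (t - N) t (by linarith)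
      rw [sub_sub_cancel] at this
      exact mul_le_mul_of_nonneg_right this ((norm_nonneg _).trans (hB 0))
    · rw [← intervalIntegral.integral_const_mul]
      refine intervalIntegral.norm_integral_le_of_norm_le (by linarith)
        (Eventually.of_forall fun u hu => ?_) ?_
      · rw [← mul_assoc]
        exact (ContinuousLinearMap.le_opNorm _ _).trans
          (mul_le_mul_of_nonneg_right (h.norm_le₁ u t hu.2) (norm_nonneg _))
      · exact ((hgn _ _).continuousOn_mul (by fun_prop)).const_mul _
  have b2 : ‖X t ((1 - P) (Y t (y t)))‖ ≤ K₂ * Real.exp (-σ₂ * N) * B +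
      K₂ * ∫ u in t..(t + N), Real.exp (-σ₂ * (u - t)) * ‖g u‖ := by
    rw [h2]
    refine (norm_sub_le _ _).trans (add_le_add ?_ ?_)
    · refine ((X t * (1 - P) * Y (t + N)).le_opNorm_of_le (hB _)).trans ?_
      have := h.norm_le₂ (t + N) t (by linarith)
      rw [add_sub_cancel_left] at this
      exact mul_le_mul_of_nonneg_right this ((norm_nonneg _).trans (hB 0))
    · rw [← intervalIntegral.integral_const_mul]
      refine intervalIntegral.norm_integral_le_of_norm_le (by linarith)
        (Eventually.of_forall fun u hu => ?_) ?_
      · rw [← mul_assoc]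
        exact (ContinuousLinearMap.le_opNorm _ _).trans
          (mul_le_mul_of_nonneg_right (h.norm_le₂ u t hu.1.le) (norm_nonneg _))
      · exact ((hgn _ _).continuousOn_mul (by fun_prop)).const_mul _
  rw [hsplit]
  refine (norm_add_le _ _).trans ?_
  exact add_le_add b1 b2

end Dichotomous

/-- Exponentially weighted integrals over the past are controlled by means over unit intervals. -/
theorem integral_exp_mul_le_of_mean_le {φ : ℝ → ℝ} (hφ0 : ∀ t, 0 ≤ φ t)
    (hφ : ∀ a b, IntervalIntegrable φ volume a b) {η : ℝ}
    (hη : ∀ a, ∫ s in a..(a + 1), φ s ≤ η) {σ : ℝ} (hσ : 0 < σ) (t : ℝ) (N : ℕ) :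
    ∫ u in (t - N)..t, Real.exp (-σ * (t - u)) * φ u ≤ (1 - Real.exp (-σ))⁻¹ * η := by
  have hint : ∀ a b, IntervalIntegrable (fun u => Real.exp (-σ * (t - u)) * φ u) volume a b :=
    fun a b => (hφ a b).continuousOn_mul (by fun_prop)
  have hη0 : 0 ≤ η :=
    (intervalIntegral.integral_nonneg (by linarith) fun u _ => hφ0 u).trans (hη 0)
  have hlt : Real.exp (-σ) < 1 := by simpa using hσ
  have key : ∫ u in (t - N)..t, Real.exp (-σ * (t - u)) * φ u
      ≤ (∑ k ∈ Finset.range N, Real.exp (-σ) ^ k) * η := by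
    induction N with
    | zero => simp
    | succ N ih =>
      have e : t - ((N + 1 : ℕ) : ℝ) + 1 = t - N := by push_cast; ring
      rw [← intervalIntegral.integral_add_adjacent_intervals (hint _ (t - N)) (hint _ _),
        Finset.sum_range_succ, add_mul, add_comm]
      refine add_le_add ih ?_
      calc ∫ u in (t - ((N + 1 : ℕ) : ℝ))..(t - N), Real.exp (-σ * (t - u)) * φ u
          ≤ ∫ u in (t - ((N + 1 : ℕ) : ℝ))..(t - N), Real.exp (-σ) ^ N * φ u := by
            refine intervalIntegral.integral_mono_on (by linarith) (hint _ _)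
              ((hφ _ _).const_mul _) fun u hu => ?_
            refine mul_le_mul_of_nonneg_right ?_ (hφ0 u)
            rw [← Real.exp_nat_mul, Real.exp_le_exp]
            nlinarith [hu.2]
        _ = Real.exp (-σ) ^ N * ∫ u in (t - ((N + 1 : ℕ) : ℝ))..(t - N), φ u :=
            intervalIntegral.integral_const_mul _ _
        _ ≤ Real.exp (-σ) ^ N * η := by
            refine mul_le_mul_of_nonneg_left ?_ (by positivity)
            rw [← e]
            exact hη _
  refine key.trans (mul_le_mul_of_nonneg_right ?_ hη0)
  rw [← tsum_geometric_of_lt_one (Real.exp_pos _).le hlt]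
  exact (summable_geometric_of_lt_one (Real.exp_pos _).le hlt).sum_le_tsum _
    fun k _ => by positivity

/-- Exponentially weighted integrals over the future are controlled by means over unit intervals:
the case of the past, reflected. -/
theorem integral_exp_mul_le_of_mean_le' {φ : ℝ → ℝ} (hφ0 : ∀ t, 0 ≤ φ t)
    (hφ : ∀ a b, IntervalIntegrable φ volume a b) {η : ℝ}
    (hη : ∀ a, ∫ s in a..(a + 1), φ s ≤ η) {σ : ℝ} (hσ : 0 < σ) (t : ℝ) (N : ℕ) :
    ∫ u in t..(t + N), Real.exp (-σ * (u - t)) * φ u ≤ (1 - Real.exp (-σ))⁻¹ * η := by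
  have h := integral_exp_mul_le_of_mean_le (φ := fun u => φ (-u)) (fun u => hφ0 _)
    (fun a b => by simpa using (hφ (-a) (-b)).comp_sub_left 0) (η := η) (fun a => by
      rw [intervalIntegral.integral_comp_neg]
      simpa using hη (-(a + 1))) hσ (-t) N
  have e := intervalIntegral.integral_comp_neg (a := -t - N) (b := -t)
    (fun u => Real.exp (-σ * (u - t)) * φ u)
  simp only [neg_neg, neg_sub, sub_neg_eq_add] at e
  rw [add_comm t, ← e]
  refine le_of_eq_of_le ?_ h
  refine intervalIntegral.integral_congr fun u _ => ?_
  congr 3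
  ring

namespace Dichotomous

variable [CompleteSpace E]

/-- The a priori estimate: a bounded solution of `y' = A y + g` is bounded in terms of the means of
`‖g‖` over unit intervals. With `g = 0` it gives the uniqueness of bounded solutions. -/
theorem norm_le_of_mean_le (h : Dichotomous A X Y P K₁ σ₁ K₂ σ₂) {y g : ℝ → E}
    (hy : Continuous y) (hy' : ∀ t, HasDerivWithinAt y (A t (y t) + g t) (Ici t) t)
    (hg : AEStronglyMeasurable g volume) {M : ℝ} (hM : ∀ t, ‖g t‖ ≤ M)
    {B : ℝ} (hB : ∀ t, ‖y t‖ ≤ B) {η : ℝ} (hη : ∀ a, ∫ s in a..(a + 1), ‖g s‖ ≤ η) (t : ℝ) :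
    ‖y t‖ ≤ (K₁ * (1 - Real.exp (-σ₁))⁻¹ + K₂ * (1 - Real.exp (-σ₂))⁻¹) * η := by
  have hgn : ∀ a b, IntervalIntegrable (fun u => ‖g u‖) volume a b := fun a b =>
    (intervalIntegrable_of_norm_le hg hM a b).norm
  have hlim : ∀ {K σ : ℝ}, 0 < σ →
      Tendsto (fun N : ℕ => K * Real.exp (-σ * N) * B) atTop (𝓝 0) := by
    intro K σ hσ
    have h1 : Tendsto (fun N : ℕ => Real.exp (-σ * N)) atTop (𝓝 0) :=
      Real.tendsto_exp_atBot.comp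
        (tendsto_natCast_atTop_atTop.const_mul_atTop_of_neg (by linarith))
    simpa using (h1.const_mul K).mul_const B
  have hlim' := ((hlim (K := K₁) h.σ₁_pos).add_const (K₁ * ((1 - Real.exp (-σ₁))⁻¹ * η))).add
    ((hlim (K := K₂) h.σ₂_pos).add_const (K₂ * ((1 - Real.exp (-σ₂))⁻¹ * η)))
  have := ge_of_tendsto' hlim' fun N => (h.norm_le_add_integral hy hy' hg hM hB t
    (Nat.cast_nonneg N)).trans (add_le_add
      (add_le_add le_rfl (mul_le_mul_of_nonneg_left (integral_exp_mul_le_of_mean_le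
        (fun u => norm_nonneg _) hgn hη h.σ₁_pos t N) h.K₁_pos.le))
      (add_le_add le_rfl (mul_le_mul_of_nonneg_left (integral_exp_mul_le_of_mean_le'
        (fun u => norm_nonneg _) hgn hη h.σ₂_pos t N) h.K₂_pos.le)))
  linarith

theorem eq_of_bounded (h : Dichotomous A X Y P K₁ σ₁ K₂ σ₂) {y z g : ℝ → E}
    (hy : Continuous y) (hy' : ∀ t, HasDerivWithinAt y (A t (y t) + g t) (Ici t) t)
    (hz : Continuous z) (hz' : ∀ t, HasDerivWithinAt z (A t (z t) + g t) (Ici t) t)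
    (hyb : IsBdd y) (hzb : IsBdd z) : y = z := by
  obtain ⟨B, hB⟩ := hyb
  obtain ⟨C, hC⟩ := hzb
  funext t
  have := h.norm_le_of_mean_le (y := y - z) (g := 0) (M := 0) (B := B + C) (η := 0)
    (hy.sub hz) (fun t => ((hy' t).sub (hz' t)).congr_deriv (by simp))
    aestronglyMeasurable_zero (by simp)
    (fun t => (norm_sub_le _ _).trans (add_le_add (hB t) (hC t))) (by simp) t
  rw [mul_zero, norm_le_zero_iff] at this
  exact sub_eq_zero.1 this

/-- The bounded solution: it is given by Green's formula
`x t = ∫_{-∞}^t X(t) P X⁻¹(s) f(s) ds - ∫_t^∞ X(t) (1 - P) X⁻¹(s) f(s) ds`, and at the same time by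
variation of constants, from which its derivatives are read off. -/
theorem exists_bounded (h : Dichotomous A X Y P K₁ σ₁ K₂ σ₂) {f : ℝ → E}
    (hf : AEStronglyMeasurable f volume) {M : ℝ} (hM : ∀ t, ‖f t‖ ≤ M) :
    ∃ v : E, ∀ t, ‖X t (v + ∫ s in (0 : ℝ)..t, Y s (f s))‖ ≤ (K₁ / σ₁ + K₂ / σ₂) * M := by
  have hYf := h.aestronglyMeasurable_inv_apply hf
  have hM0 : 0 ≤ M := (norm_nonneg _).trans (hM 0)
  -- the majorants of the two Green integrands
  have hm1 : ∀ t, IntegrableOn (fun s => K₁ * Real.exp (-σ₁ * t) * M * Real.exp (σ₁ * s))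
      (Iic t) := fun t => (integrableOn_exp_mul_Iic h.σ₁_pos t).const_mul _
  have hm2 : ∀ t, IntegrableOn (fun s => K₂ * Real.exp (σ₂ * t) * M * Real.exp (-σ₂ * s))
      (Ioi t) := fun t => (integrableOn_exp_mul_Ioi (neg_neg_of_pos h.σ₂_pos) t).const_mul _
  have hb1 : ∀ t, ∀ s ∈ Iic t, ‖X t (P (Y s (f s)))‖ ≤
      K₁ * Real.exp (-σ₁ * t) * M * Real.exp (σ₁ * s) := fun t s hs => by
    refine ((X t * P * Y s).le_of_opNorm_le_of_le (h.norm_le₁ s t hs) (hM s)).trans (le_of_eq ?_)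
    rw [show -σ₁ * (t - s) = -σ₁ * t + σ₁ * s by ring, Real.exp_add]
    ring
  have hb2 : ∀ t, ∀ s ∈ Ioi t, ‖X t ((1 - P) (Y s (f s)))‖ ≤
      K₂ * Real.exp (σ₂ * t) * M * Real.exp (-σ₂ * s) := fun t s hs => by
    refine ((X t * (1 - P) * Y s).le_of_opNorm_le_of_le
      (h.norm_le₂ s t (le_of_lt hs)) (hM s)).trans (le_of_eq ?_)
    rw [show -σ₂ * (s - t) = σ₂ * t + -σ₂ * s by ring, Real.exp_add]
    ring
  have hX1 : ∀ t, IntegrableOn (fun s => X t (P (Y s (f s)))) (Iic t) := fun t =>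
    (hm1 t).mono' ((X t * P).continuous.comp_aestronglyMeasurable hYf).restrict
      ((ae_restrict_iff' measurableSet_Iic).2 (Eventually.of_forall (hb1 t)))
  have hX2 : ∀ t, IntegrableOn (fun s => X t ((1 - P) (Y s (f s)))) (Ioi t) := fun t =>
    (hm2 t).mono' ((X t * (1 - P)).continuous.comp_aestronglyMeasurable hYf).restrict
      ((ae_restrict_iff' measurableSet_Ioi).2 (Eventually.of_forall (hb2 t)))
  have hi1 : ∀ t, IntegrableOn (fun s => P (Y s (f s))) (Iic t) := fun t => by
    simpa only [IntegrableOn, h.inv_apply] using (Y t).integrable_comp (hX1 t)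
  have hi2 : ∀ t, IntegrableOn (fun s => (1 - P) (Y s (f s))) (Ioi t) := fun t => by
    simpa only [IntegrableOn, h.inv_apply] using (Y t).integrable_comp (hX2 t)
  refine ⟨(∫ s in Iic 0, P (Y s (f s))) - ∫ s in Ioi 0, (1 - P) (Y s (f s)), fun t => ?_⟩
  have hgreen : (∫ s in Iic 0, P (Y s (f s))) - (∫ s in Ioi 0, (1 - P) (Y s (f s))) +
      ∫ s in (0 : ℝ)..t, Y s (f s) =
      (∫ s in Iic t, P (Y s (f s))) - ∫ s in Ioi t, (1 - P) (Y s (f s)) := by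
    have e1 := intervalIntegral.integral_Iic_sub_Iic (hi1 0) (hi1 t)
    have e2 := intervalIntegral.integral_interval_add_Ioi (hi2 0) (hi2 t)
    have hint := h.intervalIntegrable_inv_apply hf hM 0 t
    have e3 : ∫ s in (0 : ℝ)..t, Y s (f s) =
        (∫ s in (0 : ℝ)..t, P (Y s (f s))) + ∫ s in (0 : ℝ)..t, (1 - P) (Y s (f s)) := by
      rw [P.intervalIntegral_comp_comm hint, (1 - P).intervalIntegral_comp_comm hint,
        ← add_apply]
      simp
    rw [e3, ← e1, ← e2]
    abel
  rw [hgreen, map_sub, ← (X t).integral_comp_comm (hi1 t), ← (X t).integral_comp_comm (hi2 t)]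
  refine (norm_sub_le _ _).trans ?_
  rw [add_mul]
  refine add_le_add ?_ ?_
  · refine (norm_integral_le_of_norm_le (hm1 t)
      ((ae_restrict_iff' measurableSet_Iic).2 (Eventually.of_forall (hb1 t)))).trans (le_of_eq ?_)
    rw [integral_const_mul, integral_exp_mul_Iic h.σ₁_pos]
    have : Real.exp (-σ₁ * t) * Real.exp (σ₁ * t) = 1 := by rw [← Real.exp_add]; simp
    linear_combination K₁ * M / σ₁ * this
  · refine (norm_integral_le_of_norm_le (hm2 t)
      ((ae_restrict_iff' measurableSet_Ioi).2 (Eventually.of_forall (hb2 t)))).trans (le_of_eq ?_)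
    rw [integral_const_mul, integral_exp_mul_Ioi (neg_neg_of_pos h.σ₂_pos), neg_div_neg_eq]
    have : Real.exp (σ₂ * t) * Real.exp (-σ₂ * t) = 1 := by rw [← Real.exp_add]; simp
    linear_combination K₂ * M / σ₂ * this

theorem continuous_apply (h : Dichotomous A X Y P K₁ σ₁ K₂ σ₂) {f : ℝ → E}
    (hf : AEStronglyMeasurable f volume) {M : ℝ} (hM : ∀ t, ‖f t‖ ≤ M) (v : E) :
    Continuous fun u => X u (v + ∫ w in (0 : ℝ)..u, Y w (f w)) :=
  (continuous_iff_continuousAt.2 fun t => (h.hasDerivAt t).continuousAt).clm_apply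
    (continuous_const.add
      (intervalIntegral.continuous_primitive (h.intervalIntegrable_inv_apply hf hM) 0))

/-- Differentiation of the variation of constants formula at `t`, on a one-sided or two-sided
neighbourhood `s` of `t`; only the limit `c` of `f` along almost all points of `s'`
matters, not the value `f t`. -/
theorem hasDerivWithinAt_apply (h : Dichotomous A X Y P K₁ σ₁ K₂ σ₂) {f : ℝ → E}
    (hf : AEStronglyMeasurable f volume) {M : ℝ} (hM : ∀ t, ‖f t‖ ≤ M) (v : E) {t : ℝ} {c : E}
    {s s' : Set ℝ} [intervalIntegral.FTCFilter t (𝓝[s] t) (𝓝[s'] t)]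
    (hc : Tendsto f (𝓝[s'] t ⊓ ae volume) (𝓝 c)) :
    HasDerivWithinAt (fun u => X u (v + ∫ w in (0 : ℝ)..u, Y w (f w)))
      (A t (X t (v + ∫ w in (0 : ℝ)..t, Y w (f w))) + c) s t := by
  have h1 : HasDerivWithinAt (fun u => ∫ w in (0 : ℝ)..u, Y w (f w)) (Y t c) s t := by
    refine intervalIntegral.integral_hasDerivWithinAt_of_tendsto_ae_right (s := s) (t := s')
      (h.intervalIntegrable_inv_apply hf hM 0 t)
      (h.aestronglyMeasurable_inv_apply hf).stronglyMeasurableAtFilter ?_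
    have h2 : Tendsto Y (𝓝[s'] t ⊓ ae volume) (𝓝 (Y t)) :=
      (h.continuous_inv.tendsto t).mono_left (inf_le_left.trans nhdsWithin_le_nhds)
    exact (isBoundedBilinearMap_apply.continuous.tendsto (Y t, c)).comp (h2.prodMk_nhds hc)
  refine ((h.hasDerivAt t).hasDerivWithinAt.clm_apply (h1.const_add v)).congr_deriv ?_
  simp [h.apply_inv]

end Dichotomous

end Dichotomy

/-! ### Common almost periods -/

section Translates

variable {E : Type*} [NormedAddCommGroup E]

/-- Since each sequence lies in the `ε`-neighbourhood of the other, the exceptional set can be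
described by `θ₂` alone. -/
theorem FunEquiv.norm_sub_lt {ε : ℝ} (hε : 0 < ε) {θ₁ θ₂ : ℤ → ℝ} {u₁ u₂ : ℝ → E}
    (h : FunEquiv ε θ₁ u₁ θ₂ u₂) {t : ℝ} (ht : ∀ i, 2 * ε ≤ |t - θ₂ i|) :
    ‖u₁ t - u₂ t‖ < ε := by
  have hnot : ∀ {x : ℝ}, ε ≤ |t - x| → t ∉ Ioo (x - ε) (x + ε) := fun hx hmem =>
    absurd (abs_lt.2 ⟨by linarith [hmem.1], by linarith [hmem.2]⟩) (not_lt.2 hx)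
  exact h.2 t fun i => ⟨hnot (h.1.le_abs_sub (fun j => by linarith [ht j]) i),
    hnot (by linarith [ht i])⟩

/-- The two ingredients of a common `δ`-almost period of a Bohr almost periodic `A` and a
Bohr–Wexler almost periodic `f`; for the latter the exceptional set is the `δ`-neighbourhood of
some translate of `θ`. -/
theorem relDense_common_almostPeriod {F : Type*} [NormedAddCommGroup F] {A : ℝ → F} (hA : IsAP A)
    {θ : ℤ → ℝ} {f : ℝ → E} (hf : IsBWAP θ f) {δ : ℝ} (hδ : 0 < δ) :
    RelDense {τ | (∀ t, ‖A (t + τ) - A t‖ ≤ δ) ∧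
      ∃ c, ∀ t, (∀ i, δ ≤ |t - c - θ i|) → ‖f (t + τ) - f t‖ ≤ δ} := by
  have he : 0 < δ / 3 := by linarith
  obtain ⟨r, hr, hr'⟩ := Metric.uniformContinuous_iff.1 hA.2.1 (δ / 3) he
  refine ((hf.2.2 (δ / 3) he).sub_near_sub (hA.2.2 (δ / 3) he) hr).mono ?_
  rintro τ ⟨u, hu, u', hu', v, hv, v', hv', rfl, hlt⟩
  refine ⟨fun t => ?_, u', fun t ht => ?_⟩
  · have h1 : ‖A (t + (u - u')) - A (t - v' + v)‖ < δ / 3 := by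
      rw [← dist_eq_norm]
      refine hr' ?_
      rw [Real.dist_eq]
      convert hlt using 2
      ring
    have h2 := hv (t - v')
    have h3 := hv' (t - v')
    rw [sub_add_cancel] at h3
    have h4 := norm_sub_le_norm_sub_add_norm_sub (A (t + (u - u'))) (A (t - v' + v)) (A (t - v'))
    have h5 := norm_sub_le_norm_sub_add_norm_sub (A (t + (u - u'))) (A (t - v')) (A t)
    rw [norm_sub_rev (A (t - v')) (A t)] at h5
    linarith
  · have ht' : ∀ i, 2 * (δ / 3) ≤ |t - u' - θ i| := fun i => by linarith [ht i]
    have h1 := FunEquiv.norm_sub_lt he hu ht'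
    have h2 := FunEquiv.norm_sub_lt he hu' ht'
    have h3 := norm_sub_le_norm_sub_add_norm_sub (f (t - u' + u)) (f (t - u')) (f (t - u' + u'))
    rw [norm_sub_rev (f (t - u')) (f (t - u' + u'))] at h3
    rw [sub_add_cancel] at h2 h3
    rw [show t + (u - u') = t - u' + u by ring]
    linarith

/-- Differences of late members of a regular sequence are common `δ`-almost periods, in the sense of
`relDense_common_almostPeriod`. -/
theorem exists_almostPeriod_of_regular {F : Type*} [NormedAddCommGroup F] {A : ℝ → F}
    {θ : ℤ → ℝ} {f : ℝ → E} {h : ℕ → ℝ} (hA : h ∈ regAP A) (hf : h ∈ regB θ f) {δ : ℝ}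
    (hδ : 0 < δ) :
    ∃ N, ∀ n ≥ N, ∀ m ≥ N, (∀ t, ‖A (t + (h n - h m)) - A t‖ ≤ δ) ∧
      ∀ t, (∀ i, δ ≤ |t - θ i|) → ‖f (t + (h n - h m)) - f t‖ ≤ δ := by
  obtain ⟨B, hB⟩ := hA
  obtain ⟨η, ψ, -, hψ⟩ := hf
  have he : 0 < δ / 3 := by linarith
  obtain ⟨N, hN⟩ := eventually_atTop.1
    ((Metric.tendstoUniformly_iff.1 hB (δ / 3) he).and (hψ (δ / 3) he))
  refine ⟨N, fun n hn m hm => ⟨fun t => ?_, fun t ht => ?_⟩⟩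
  · have h1 := (hN n hn).1 (t - h m)
    have h2 := (hN m hm).1 (t - h m)
    rw [sub_add_cancel] at h2
    have h3 := dist_triangle_left (A (t - h m + h n)) (A t) (B (t - h m))
    rw [show t + (h n - h m) = t - h m + h n by ring, ← dist_eq_norm]
    linarith
  · -- of the distance `δ` to `θ`, one third is spent on passing to `η`, another one on passing
    -- from `η` to `θ - h n`
    have hη : ∀ i, 2 * (δ / 3) ≤ |t - h m - η i| :=
      (hN m hm).2.1.symm.le_abs_sub fun j => by
        rw [show t - h m - (θ j - h m) = t - θ j by ring]
        linarith [ht j]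
    have h1 := (hN n hn).2.norm_sub_lt he hη
    have h2 := (hN m hm).2.norm_sub_lt he hη
    have h3 := norm_sub_le_norm_sub_add_norm_sub (f (t - h m + h n)) (ψ (t - h m))
      (f (t - h m + h m))
    rw [norm_sub_rev (ψ (t - h m)) (f (t - h m + h m))] at h3
    rw [sub_add_cancel] at h2 h3
    rw [show t + (h n - h m) = t - h m + h n by ring]
    linarith

theorem mem_regAP_of_cauchy [CompleteSpace E] {x : ℝ → E} {h : ℕ → ℝ}
    (H : ∀ ε : ℝ, 0 < ε → ∃ N, ∀ n ≥ N, ∀ m ≥ N, ∀ t, ‖x (t + (h n - h m)) - x t‖ < ε) :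
    h ∈ regAP x := by
  have hC : UniformCauchySeqOn (fun n t => x (t + h n)) atTop univ := by
    rw [Metric.uniformCauchySeqOn_iff]
    intro ε hε
    obtain ⟨N, hN⟩ := H ε hε
    refine ⟨N, fun n hn m hm t _ => ?_⟩
    have := hN n hn m hm (t + h m)
    rwa [show t + h m + (h n - h m) = t + h n by ring, ← dist_eq_norm] at this
  choose ψ hψ using fun t => cauchySeq_tendsto_of_complete (hC.cauchySeq (mem_univ t))
  exact ⟨ψ, tendstoUniformlyOn_univ.1 (hC.tendstoUniformlyOn_of_tendsto fun t _ => hψ t)⟩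

variable [NormedSpace ℝ E]

theorem uniformContinuous_of_deriv_right_bounded {x x' : ℝ → E} (hx : Continuous x)
    (hx' : ∀ t, HasDerivWithinAt x (x' t) (Ici t) t) {C : ℝ} (hC : ∀ t, ‖x' t‖ ≤ C) :
    UniformContinuous x := by
  have hle : ∀ s t, s ≤ t → ‖x t - x s‖ ≤ C * (t - s) := fun s t hst =>
    norm_image_sub_le_of_norm_deriv_right_le_segment hx.continuousOn (fun u _ => hx' u)
      (fun u _ => hC u) t ⟨hst, le_rfl⟩
  have hL : LipschitzWith C.toNNReal x := by
    refine LipschitzWith.of_dist_le_mul fun s t => ?_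
    rw [Real.coe_toNNReal C ((norm_nonneg _).trans (hC 0)), dist_eq_norm, Real.dist_eq]
    rcases le_total s t with hst | hst
    · rw [norm_sub_rev, abs_sub_comm, abs_of_nonneg (sub_nonneg.2 hst)]
      exact hle s t hst
    · rw [abs_of_nonneg (sub_nonneg.2 hst)]
      exact hle t s hst
  exact hL.uniformContinuous

variable [CompleteSpace E] {A X Y : ℝ → E →L[ℝ] E} {P : E →L[ℝ] E} {K₁ σ₁ K₂ σ₂ : ℝ}

/-- Common almost periods of `A` and `f` are almost periods of a bounded solution `x`: the
difference `x (· + τ) - x` solves the equation with a right-hand side whose means over unit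
intervals are small, the exceptional neighbourhoods of `θ` contributing little to them. -/
theorem Dichotomous.exists_translate_lt (h : Dichotomous A X Y P K₁ σ₁ K₂ σ₂) (hA : Continuous A)
    {θ : ℤ → ℝ} (hθ : IsWexler θ) {f x : ℝ → E} (hf : AEStronglyMeasurable f volume) {M : ℝ}
    (hM : ∀ t, ‖f t‖ ≤ M) (hx : Continuous x)
    (hx' : ∀ t, HasDerivWithinAt x (A t (x t) + f t) (Ici t) t) {B : ℝ} (hB : ∀ t, ‖x t‖ ≤ B)
    {ε : ℝ} (hε : 0 < ε) :
    ∃ δ : ℝ, 0 < δ ∧ ∀ τ c, (∀ t, ‖A (t + τ) - A t‖ ≤ δ) →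
      (∀ t, (∀ i, δ ≤ |t - c - θ i|) → ‖f (t + τ) - f t‖ ≤ δ) →
      ∀ t, ‖x (t + τ) - x t‖ < ε := by
  obtain ⟨N, hN⟩ := hθ.exists_card_bound
  have hB0 : 0 ≤ B := (norm_nonneg _).trans (hB 0)
  have hM0 : 0 ≤ M := (norm_nonneg _).trans (hM 0)
  set C := (K₁ * (1 - Real.exp (-σ₁))⁻¹ + K₂ * (1 - Real.exp (-σ₂))⁻¹) *
    (B + (1 + 2 * (M + M) * N)) with hC
  have hC0 : 0 ≤ C := by
    have h1 : 0 ≤ (1 - Real.exp (-σ₁))⁻¹ :=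
      inv_nonneg.2 (sub_nonneg.2 (Real.exp_le_one_iff.2 (by linarith [h.σ₁_pos])))
    have h2 : 0 ≤ (1 - Real.exp (-σ₂))⁻¹ :=
      inv_nonneg.2 (sub_nonneg.2 (Real.exp_le_one_iff.2 (by linarith [h.σ₂_pos])))
    have := h.K₁_pos.le
    have := h.K₂_pos.le
    positivity
  refine ⟨min 1 (ε / (C + 1)), by positivity, fun τ c hτA hτf t => ?_⟩
  set δ := min 1 (ε / (C + 1)) with hδ
  have hδ0 : 0 < δ := by positivity
  have hfτ : AEStronglyMeasurable (fun t => f (t + τ) - f t) volume :=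
    (hf.comp_quasiMeasurePreserving
      (measurePreserving_add_right volume τ).quasiMeasurePreserving).sub hf
  have hfτM : ∀ t, ‖f (t + τ) - f t‖ ≤ M + M := fun t =>
    (norm_sub_le _ _).trans (add_le_add (hM _) (hM _))
  have hAx : Continuous fun t => (A (t + τ) - A t) (x (t + τ)) := by fun_prop
  have hAxB : ∀ t, ‖(A (t + τ) - A t) (x (t + τ))‖ ≤ δ * B := fun t =>
    (A (t + τ) - A t).le_of_opNorm_le_of_le (hτA t) (hB _)
  set g : ℝ → E := fun t => (A (t + τ) - A t) (x (t + τ)) + (f (t + τ) - f t) with hg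
  have hgm : AEStronglyMeasurable g volume := hAx.aestronglyMeasurable.add hfτ
  have hgle : ∀ t, ‖g t‖ ≤ δ * B + ‖f (t + τ) - f t‖ := fun t =>
    (norm_add_le _ _).trans (add_le_add (hAxB t) le_rfl)
  have hgM : ∀ t, ‖g t‖ ≤ δ * B + (M + M) := fun t =>
    (hgle t).trans (add_le_add le_rfl (hfτM t))
  have hmean : ∀ a, ∫ s in a..(a + 1), ‖g s‖ ≤ (B + (1 + 2 * (M + M) * N)) * δ := fun a => by
    have h1 := (intervalIntegrable_of_norm_le hfτ hfτM a (a + 1)).norm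
    calc ∫ s in a..(a + 1), ‖g s‖ ≤ ∫ s in a..(a + 1), (δ * B + ‖f (s + τ) - f s‖) :=
          intervalIntegral.integral_mono_on (by linarith)
            (intervalIntegrable_of_norm_le hgm hgM a (a + 1)).norm
            (intervalIntegrable_const.add h1) fun s _ => hgle s
      _ = δ * B + ∫ s in a..(a + 1), ‖f (s + τ) - f s‖ := by
          rw [intervalIntegral.integral_add intervalIntegrable_const h1]
          simp
      _ ≤ δ * B + (1 + 2 * (M + M) * N) * δ := by
          gcongr
          exact integral_norm_le_of_le_off_nhds hN hfτ hfτM hδ0 (min_le_left _ _) hτf a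
      _ = _ := by ring
  have hxτ : ∀ t, HasDerivWithinAt (fun t => x (t + τ))
      (A (t + τ) (x (t + τ)) + f (t + τ)) (Ici t) t := fun t => by
    have h1 : HasDerivWithinAt (fun t => t + τ) (1 : ℝ) (Ici t) t :=
      ((hasDerivAt_id t).add_const τ).hasDerivWithinAt
    have h2 := (hx' (t + τ)).scomp t h1 fun s (hs : t ≤ s) => show t + τ ≤ s + τ by linarith
    rwa [one_smul] at h2
  have hmain := h.norm_le_of_mean_le (y := fun t => x (t + τ) - x t) (g := g) (by fun_prop)
    (fun t => ((hxτ t).sub (hx' t)).congr_deriv (by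
      simp only [hg, sub_apply, map_sub]
      abel)) hgm hgM
    (fun t => (norm_sub_le _ _).trans (add_le_add (hB _) (hB _))) hmean t
  calc ‖x (t + τ) - x t‖ ≤ C * δ := by rw [hC, mul_assoc]; exact hmain
    _ ≤ C * (ε / (C + 1)) := by gcongr; exact min_le_right _ _
    _ < ε := by
      rw [mul_div_assoc', div_lt_iff₀ (by linarith)]
      nlinarith

end Translates

/-! ### Passage from matrices to operators -/

section Matrix

variable {n : ℕ}

theorem ExpDichotomy.dichotomous {A X : ℝ → Matrix (Fin n) (Fin n) ℝ}
    {P : Matrix (Fin n) (Fin n) ℝ} {K₁ σ₁ K₂ σ₂ : ℝ} (hX : IsFundamental A X)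
    (h : ExpDichotomy X P K₁ σ₁ K₂ σ₂) :
    Dichotomous (fun t => Matrix.toEuclideanCLM (𝕜 := ℝ) (A t))
      (fun t => Matrix.toEuclideanCLM (𝕜 := ℝ) (X t))
      (fun t => Matrix.toEuclideanCLM (𝕜 := ℝ) (X t)⁻¹) (Matrix.toEuclideanCLM (𝕜 := ℝ) P)
      K₁ σ₁ K₂ σ₂ := by
  obtain ⟨-, hK₁, hσ₁, hK₂, hσ₂, h1, h2⟩ := h
  refine ⟨fun t => ?_, fun t => ?_, fun t => ?_, hK₁, hσ₁, hK₂, hσ₂, fun s t hst => ?_,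
    fun s t hst => ?_⟩
  · have hL := (LinearMap.toContinuousLinearMap
      (Matrix.toEuclideanCLM (n := Fin n) (𝕜 := ℝ)).toAlgEquiv.toLinearMap).hasFDerivAt
        |>.comp_hasDerivAt t (hX t).1
    refine hL.congr_deriv ?_
    exact map_mul (Matrix.toEuclideanCLM (n := Fin n) (𝕜 := ℝ)) (A t) (X t)
  · rw [← map_mul, Matrix.mul_nonsing_inv _ (hX t).2, map_one]
  · rw [← map_mul, Matrix.nonsing_inv_mul _ (hX t).2, map_one]
  · rw [← map_mul, ← map_mul]
    exact h1 s t hst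
  · rw [← map_one (Matrix.toEuclideanCLM (n := Fin n) (𝕜 := ℝ)), ← map_sub, ← map_mul, ← map_mul]
    exact h2 s t hst

theorem IsSol.hasDerivWithinAt_Ici {θ : ℤ → ℝ} {A : ℝ → Matrix (Fin n) (Fin n) ℝ}
    {f x : ℝ → EuclideanSpace ℝ (Fin n)} (h : IsSol θ A f x) (t : ℝ) :
    HasDerivWithinAt x (Matrix.toEuclideanCLM (𝕜 := ℝ) (A t) (x t) + f t) (Ici t) t := by
  by_cases ht : t ∈ range θ
  · obtain ⟨i, rfl⟩ := ht
    exact h.2.2.1 i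
  · exact (h.2.1 t ht).hasDerivWithinAt

end Matrix

end BWAP

theorem mainTheorem10 {n : ℕ}
    (A X : ℝ → Matrix (Fin n) (Fin n) ℝ) (P : Matrix (Fin n) (Fin n) ℝ)
    (K₁ σ₁ K₂ σ₂ : ℝ)
    (hA : BWAP.IsAP A) (hX : BWAP.IsFundamental A X)
    (hdich : BWAP.ExpDichotomy X P K₁ σ₁ K₂ σ₂)
    (θ : ℤ → ℝ) (f : ℝ → EuclideanSpace ℝ (Fin n))
    (hf : BWAP.IsBWAP θ f) (hfb : BWAP.IsBdd f) :
    ∃ x₀ : ℝ → EuclideanSpace ℝ (Fin n),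
      BWAP.IsAP x₀ ∧ BWAP.IsSol θ A f x₀ ∧
      (∀ y : ℝ → EuclideanSpace ℝ (Fin n), BWAP.IsAP y → BWAP.IsSol θ A f y → y = x₀) ∧
      BWAP.regAP A ∩ BWAP.regB θ f ⊆ BWAP.regAP x₀ ∧
      BWAP.supNorm x₀ ≤ (K₁ / σ₁ + K₂ / σ₂) * BWAP.supNorm f := by
  have h := hdich.dichotomous hX
  have hfm := hf.1.aestronglyMeasurable
  have hfM : ∀ t, ‖f t‖ ≤ BWAP.supNorm f := by
    obtain ⟨M, hM⟩ := hfb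
    exact fun t => le_ciSup (f := fun t => ‖f t‖) ⟨M, forall_mem_range.2 hM⟩ t
  obtain ⟨A₀, hA₀⟩ := hA.1
  have hAc : Continuous fun t => Matrix.toEuclideanCLM (n := Fin n) (𝕜 := ℝ) (A t) :=
    (LinearMap.continuous_of_finiteDimensional
      (Matrix.toEuclideanCLM (n := Fin n) (𝕜 := ℝ)).toAlgEquiv.toLinearMap).comp
        hA.2.1.continuous
  have hAnorm : ∀ s t, ‖Matrix.toEuclideanCLM (n := Fin n) (𝕜 := ℝ) (A s) -
      Matrix.toEuclideanCLM (n := Fin n) (𝕜 := ℝ) (A t)‖ = ‖A s - A t‖ := fun s t => by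
    rw [← map_sub]
    rfl
  obtain ⟨v, hv⟩ := h.exists_bounded hfm hfM
  set x₀ : ℝ → EuclideanSpace ℝ (Fin n) := fun t =>
    Matrix.toEuclideanCLM (n := Fin n) (𝕜 := ℝ) (X t)
      (v + ∫ s in (0 : ℝ)..t, Matrix.toEuclideanCLM (n := Fin n) (𝕜 := ℝ) (X s)⁻¹ (f s)) with hx₀
  have hright : ∀ t, HasDerivWithinAt x₀
      (Matrix.toEuclideanCLM (n := Fin n) (𝕜 := ℝ) (A t) (x₀ t) + f t) (Ici t) t := fun t =>
    h.hasDerivWithinAt_apply hfm hfM v (s' := Ioi t)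
      (((hf.1.continuousWithinAt_Ici t).mono Ioi_subset_Ici_self).mono_left inf_le_left)
  have hleft : ∀ t w, Tendsto f (𝓝[<] t) (𝓝 w) → HasDerivWithinAt x₀
      (Matrix.toEuclideanCLM (n := Fin n) (𝕜 := ℝ) (A t) (x₀ t) + w) (Iic t) t :=
    fun t w hw => h.hasDerivWithinAt_apply hfm hfM v (s' := Iic t) <| hw.mono_left <| by
      -- the point `t` itself is a null set
      have hne : ae volume ≤ 𝓟 {t}ᶜ := le_principal_iff.2 (compl_mem_ae_iff.2 (by simp))
      rw [nhdsWithin, nhdsWithin]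
      refine (inf_le_inf_left _ hne).trans ?_
      rw [inf_assoc, inf_principal]
      exact inf_le_inf_left _ (principal_mono.2 fun s hs => lt_of_le_of_ne hs.1 hs.2)
  have hsol : BWAP.IsSol θ A f x₀ := by
    refine ⟨h.continuous_apply hfm hfM v, fun t ht => ?_, fun i => hright (θ i), fun i => ?_⟩
    · have := (hleft t (f t) ((hf.1.continuousAt ht).mono_left nhdsWithin_le_nhds)).union (hright t)
      rwa [Iic_union_Ici, hasDerivWithinAt_univ] at this
    · obtain ⟨w, hw⟩ := hf.1.2.2.1 i
      exact ⟨_, hleft (θ i) w hw⟩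
  have hkey := fun {ε : ℝ} (hε : 0 < ε) =>
    h.exists_translate_lt hAc hf.2.1 hfm hfM hsol.1 hright hv hε
  simp only [hAnorm] at hkey
  refine ⟨x₀, ⟨⟨_, hv⟩, ?_, fun ε hε => ?_⟩, hsol, fun y hy hysol => ?_, fun k hk => ?_,
    ciSup_le hv⟩
  · exact BWAP.uniformContinuous_of_deriv_right_bounded hsol.1 hright fun t =>
      (norm_add_le _ _).trans (add_le_add (ContinuousLinearMap.le_of_opNorm_le_of_le _
        (hA₀ t) (hv t)) (hfM t))
  · obtain ⟨δ, hδ, H⟩ := hkey hε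
    refine (BWAP.relDense_common_almostPeriod hA hf hδ).mono ?_
    rintro τ ⟨h1, c, h2⟩
    exact H τ c h1 h2
  · exact h.eq_of_bounded hysol.1 hysol.hasDerivWithinAt_Ici hsol.1 hright hy.1 ⟨_, hv⟩
  · refine BWAP.mem_regAP_of_cauchy fun ε hε => ?_
    obtain ⟨δ, hδ, H⟩ := hkey hε
    obtain ⟨N, hN⟩ := BWAP.exists_almostPeriod_of_regular hk.1 hk.2 hδ
    refine ⟨N, fun p hp q hq => ?_⟩
    obtain ⟨h1, h2⟩ := hN p hp q hq
    exact H (k p - k q) 0 h1 (by simpa only [sub_zero] using h2)
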